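/- Let $\Delta_3$ be the subcategory of the category of finite nonempty ordinals and monotone maps with objects $\mathsf 1,\mathsf 2,\mathsf 3$ generated by the morphisms $d^0,d^1:\mathsf 1\to\mathsf 2$, $s^0:\mathsf 2\to\mathsf 1$ and $D^0,D^1,D^2:\mathsf 2\to\mathsf 3$ (where $d^i$, $D^i$ are the injections missing $i$), that is, the category with these generators subject to the relations $s^0d^1=\mathrm{id}=s^0d^0$ and $D^td^k=D^kd^{t-1}$ for $t>k$. Let $\mathsf{Cat}$ be the $2$-category of categories in some universe. A pseudofunctor $\mathcal A:\Delta_3\to\mathsf{Cat}$ has invertible structure $2$-cells $\mathfrak a_{hg}:\mathcal A(h)\mathcal A(g)\Rightarrow\mathcal A(hg)$ and $\mathfrak a_x:\mathrm{id}_{\mathcal A(x)}\Rightarrow\mathcal A(\mathrm{id}_x)$, subject to the usual associativity and identity laws. Put $$\mathcal A(\sigma_{01})=\mathfrak a_{D^0d^0}^{-1}\cdot\mathfrak a_{D^1d^0},\quad \mathcal A(\sigma_{02})=\mathfrak a_{D^0d^1}^{-1}\cdot\mathfrak a_{D^2d^0},\quad \mathcal A(\sigma_{12})=\mathfrak a_{D^1d^1}^{-1}\cdot\mathfrak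 a_{D^2d^1},$$ $$\mathcal A(\mathfrak n_0)=\mathfrak a_{\mathsf 1}^{-1}\cdot\mathfrak a_{s^0d^0},\quad \mathcal A(\mathfrak n_1)=\mathfrak a_{\mathsf 1}^{-1}\cdot\mathfrak a_{s^0d^1}.$$ The lax descent category $\mathrm{lax}\text{-}\mathcal D\mathrm{esc}(\mathcal A)$ has as objects the pairs $(w,\varphi)$ of an object $w$ of $\mathcal A(\mathsf 1)$ and a morphism $\varphi:\mathcal A(d^1)(w)\to\mathcal A(d^0)(w)$ of $\mathcal A(\mathsf 2)$ such that $$\mathcal A(D^0)(\varphi)\cdot\mathcal A(\sigma_{02})_w\cdot\mathcal A(D^2)(\varphi)=\mathcal A(\sigma_{01})_w\cdot\mathcal A(D^1)(\varphi)\cdot\mathcal A(\sigma_{12})_w,\qquad \mathcal A(\mathfrak n_0)_w\cdot\mathcal A(s^0)(\varphi)=\mathcal A(\mathfrak n_1)_w;$$ a morphism $(w,\varphi)\to(w',\varphi')$ is a morphism $\mathfrak m:w\to w'$ of $\mathcal A(\mathsf 1)$ with $\mathcal A(d^0)(\mathfrak m)\cdot\varphi=\varphi'\cdot\mathcal A(d^1)(\mathfrak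 m)$, and composition is that of $\mathcal A(\mathsf 1)$. Let $\mathrm d^{\mathcal A}:\mathrm{lax}\text{-}\mathcal D\mathrm{esc}(\mathcal A)\to\mathcal A(\mathsf 1)$, $(w,\varphi)\mapsto w$, be the functor that forgets descent data. **Theorem 2.7 (Monadicity Theorem).** Let $G:\mathcal B\to\mathcal C$ be a functor that has a left adjoint. Then $G$ is monadic (the comparison functor from $\mathcal B$ to the category of Eilenberg–Moore algebras of the induced monad on $\mathcal C$ is an equivalence) if and only if there are a pseudofunctor $\mathcal A:\Delta_3\to\mathsf{Cat}$ with $\mathcal A(\mathsf 1)=\mathcal C$ and an equivalence of categories $\mathcal K:\mathcal B\to\mathrm{lax}\text{-}\mathcal D\mathrm{esc}(\mathcal A)$ such that $G=\mathrm d^{\mathcal A}\circ\mathcal K$. -/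

import Mathlib

open CategoryTheory

universe v u u₁ u₂

/-! ## The category `Δ₃` -/

/-- The objects `1`, `2`, `3` of `Δ₃`, as vertices of the quiver of generating morphisms. -/
inductive Delta3Quiver : Type
  | one
  | two
  | three

namespace Delta3Quiver

/-- The generating morphisms `d⁰, d¹ : 1 ⟶ 2`, `s⁰ : 2 ⟶ 1` and `D⁰, D¹, D² : 2 ⟶ 3`. -/
inductive Hom : Delta3Quiver → Delta3Quiver → Type
  | d0 : Hom one two
  | d1 : Hom one two
  | s0 : Hom two one
  | D0 : Hom two three
  | D1 : Hom two three
  | D2 : Hom two three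

instance quiv : Quiver Delta3Quiver where
  Hom := Hom

/-- A generating morphism, seen as a path of length one. -/
abbrev arrow {a b : Delta3Quiver} (f : Hom a b) :
    (Paths.of Delta3Quiver).obj a ⟶ (Paths.of Delta3Quiver).obj b :=
  (Paths.of Delta3Quiver).map f

/-- The relations `s⁰ d¹ = id = s⁰ d⁰` and `Dᵗ dᵏ = Dᵏ dᵗ⁻¹` for `t > k`
(in Lean, `f ≫ g` is the composite "first `f`, then `g`"). -/
inductive Rel : HomRel (Paths Delta3Quiver)
  | s0_d1 : Rel (arrow .d1 ≫ arrow .s0) (𝟙 _)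
  | s0_d0 : Rel (arrow .d0 ≫ arrow .s0) (𝟙 _)
  | D1_d0 : Rel (arrow .d0 ≫ arrow .D1) (arrow .d0 ≫ arrow .D0)
  | D2_d0 : Rel (arrow .d0 ≫ arrow .D2) (arrow .d1 ≫ arrow .D0)
  | D2_d1 : Rel (arrow .d1 ≫ arrow .D2) (arrow .d1 ≫ arrow .D1)

end Delta3Quiver

/-- The category `Δ₃` generated by `d⁰, d¹, s⁰, D⁰, D¹, D²` subject to the cosimplicial
relations. It is isomorphic to the (non-full) subcategory of the category of finite nonempty
ordinals on the objects `1`, `2`, `3` generated by the coface maps `dⁱ : 1 ⟶ 2`, `Dⁱ : 2 ⟶ 3`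
(the injections that miss `i`) and the codegeneracy `s⁰ : 2 ⟶ 1`: every morphism has one of the
normal forms `id`, `dⁱ`, `s⁰`, `dⁱ s⁰`, `Dⁱ`, `D⁰d⁰`, `D⁰d¹`, `D¹d¹`, `D⁰d⁰s⁰`, `D⁰d¹s⁰`,
`D¹d¹s⁰`, and these are distinct monotone maps. -/
abbrev Delta3 : Type := CategoryTheory.Quotient Delta3Quiver.Rel

namespace Delta3

/-- The object `1`. -/
abbrev one : Delta3 := ⟨(Paths.of Delta3Quiver).obj .one⟩
/-- The object `2`. -/
abbrev two : Delta3 := ⟨(Paths.of Delta3Quiver).obj .two⟩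
/-- The object `3`. -/
abbrev three : Delta3 := ⟨(Paths.of Delta3Quiver).obj .three⟩

/-- The class of a generating morphism. -/
abbrev gen {a b : Delta3Quiver} (f : Delta3Quiver.Hom a b) :
    (CategoryTheory.Quotient.functor Delta3Quiver.Rel).obj ((Paths.of Delta3Quiver).obj a) ⟶
      (CategoryTheory.Quotient.functor Delta3Quiver.Rel).obj ((Paths.of Delta3Quiver).obj b) :=
  (CategoryTheory.Quotient.functor Delta3Quiver.Rel).map (Delta3Quiver.arrow f)

/-- `d⁰ : 1 ⟶ 2`. -/
def d0 : one ⟶ two := gen .d0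
/-- `d¹ : 1 ⟶ 2`. -/
def d1 : one ⟶ two := gen .d1
/-- `s⁰ : 2 ⟶ 1`. -/
def s0 : two ⟶ one := gen .s0
/-- `D⁰ : 2 ⟶ 3`. -/
def D0 : two ⟶ three := gen .D0
/-- `D¹ : 2 ⟶ 3`. -/
def D1 : two ⟶ three := gen .D1
/-- `D² : 2 ⟶ 3`. -/
def D2 : two ⟶ three := gen .D2

theorem d1_s0 : d1 ≫ s0 = 𝟙 one := CategoryTheory.Quotient.sound _ .s0_d1
theorem d0_s0 : d0 ≫ s0 = 𝟙 one := CategoryTheory.Quotient.sound _ .s0_d0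
theorem d0_D1 : d0 ≫ D1 = d0 ≫ D0 := CategoryTheory.Quotient.sound _ .D1_d0
theorem d0_D2 : d0 ≫ D2 = d1 ≫ D0 := CategoryTheory.Quotient.sound _ .D2_d0
theorem d1_D2 : d1 ≫ D2 = d1 ≫ D1 := CategoryTheory.Quotient.sound _ .D2_d1

end Delta3

/-! ## The lax descent category -/

namespace LaxDescent

open Delta3

variable (A : Pseudofunctor (LocallyDiscrete Delta3) Cat.{v, u})

/-- `A(σ₀₁) = a_{D⁰d⁰}⁻¹ · a_{D¹d⁰} : A(D¹) A(d⁰) ⟶ A(D⁰) A(d⁰)`. -/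
def sigma01 : A.map d0.toLoc ≫ A.map D1.toLoc ⟶ A.map d0.toLoc ≫ A.map D0.toLoc :=
  (A.mapComp' d0.toLoc D1.toLoc (d0 ≫ D0).toLoc (congrArg Quiver.Hom.toLoc d0_D1)).inv ≫
    (A.mapComp' d0.toLoc D0.toLoc (d0 ≫ D0).toLoc rfl).hom

/-- `A(σ₀₂) = a_{D⁰d¹}⁻¹ · a_{D²d⁰} : A(D²) A(d⁰) ⟶ A(D⁰) A(d¹)`. -/
def sigma02 : A.map d0.toLoc ≫ A.map D2.toLoc ⟶ A.map d1.toLoc ≫ A.map D0.toLoc :=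
  (A.mapComp' d0.toLoc D2.toLoc (d1 ≫ D0).toLoc (congrArg Quiver.Hom.toLoc d0_D2)).inv ≫
    (A.mapComp' d1.toLoc D0.toLoc (d1 ≫ D0).toLoc rfl).hom

/-- `A(σ₁₂) = a_{D¹d¹}⁻¹ · a_{D²d¹} : A(D²) A(d¹) ⟶ A(D¹) A(d¹)`. -/
def sigma12 : A.map d1.toLoc ≫ A.map D2.toLoc ⟶ A.map d1.toLoc ≫ A.map D1.toLoc :=
  (A.mapComp' d1.toLoc D2.toLoc (d1 ≫ D1).toLoc (congrArg Quiver.Hom.toLoc d1_D2)).inv ≫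
    (A.mapComp' d1.toLoc D1.toLoc (d1 ≫ D1).toLoc rfl).hom

/-- `A(𝔫₀) = a_1⁻¹ · a_{s⁰d⁰} : A(s⁰) A(d⁰) ⟶ id`. -/
def nu0 : A.map d0.toLoc ≫ A.map s0.toLoc ⟶ 𝟙 (A.obj ⟨one⟩) :=
  (A.mapComp' d0.toLoc s0.toLoc (𝟙 (⟨one⟩ : LocallyDiscrete Delta3)) (congrArg Quiver.Hom.toLoc d0_s0)).inv ≫
    (A.mapId ⟨one⟩).hom

/-- `A(𝔫₁) = a_1⁻¹ · a_{s⁰d¹} : A(s⁰) A(d¹) ⟶ id`. -/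
def nu1 : A.map d1.toLoc ≫ A.map s0.toLoc ⟶ 𝟙 (A.obj ⟨one⟩) :=
  (A.mapComp' d1.toLoc s0.toLoc (𝟙 (⟨one⟩ : LocallyDiscrete Delta3)) (congrArg Quiver.Hom.toLoc d1_s0)).inv ≫
    (A.mapId ⟨one⟩).hom

end LaxDescent

open Delta3 LaxDescent in
/-- An object of the lax descent category of `A`: an object `w` of `A(1)` with a descent
datum `φ : A(d¹)(w) ⟶ A(d⁰)(w)`. -/
structure LaxDesc (A : Pseudofunctor (LocallyDiscrete Delta3) Cat.{v, u}) where
  /-- the underlying object -/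
  w : A.obj ⟨one⟩
  /-- the descent datum -/
  φ : (A.map d1.toLoc).toFunctor.obj w ⟶ (A.map d0.toLoc).toFunctor.obj w
  /-- descent associativity: `A(D⁰)(φ) · A(σ₀₂)_w · A(D²)(φ) = A(σ₀₁)_w · A(D¹)(φ) · A(σ₁₂)_w` -/
  associativity :
    (A.map D2.toLoc).toFunctor.map φ ≫ (sigma02 A).toNatTrans.app w ≫
        (A.map D0.toLoc).toFunctor.map φ =
      (sigma12 A).toNatTrans.app w ≫ (A.map D1.toLoc).toFunctor.map φ ≫
        (sigma01 A).toNatTrans.app w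
  /-- descent identity: `A(𝔫₀)_w · A(s⁰)(φ) = A(𝔫₁)_w` -/
  identity :
    (A.map s0.toLoc).toFunctor.map φ ≫ (nu0 A).toNatTrans.app w = (nu1 A).toNatTrans.app w

namespace LaxDesc

open Delta3

variable {A : Pseudofunctor (LocallyDiscrete Delta3) Cat.{v, u}}

/-- A morphism of the lax descent category: a morphism of `A(1)` compatible with the descent
data. -/
@[ext]
structure Hom (x y : LaxDesc A) where
  /-- the underlying morphism of `A(1)` -/
  m : x.w ⟶ y.w
  /-- `A(d⁰)(m) · φ = φ' · A(d¹)(m)` -/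
  comm : x.φ ≫ (A.map d0.toLoc).toFunctor.map m = (A.map d1.toLoc).toFunctor.map m ≫ y.φ

/-- The lax descent category, with the composition of `A(1)`. -/
instance category : Category.{v} (LaxDesc A) where
  Hom := Hom
  id x := { m := 𝟙 x.w, comm := by simp }
  comp f g :=
    { m := f.m ≫ g.m
      comm := by
        rw [Functor.map_comp, Functor.map_comp, ← Category.assoc, f.comm, Category.assoc, g.comm,
          Category.assoc] }
  id_comp f := Hom.ext (Category.id_comp f.m)
  comp_id f := Hom.ext (Category.comp_id f.m)
  assoc f g h := Hom.ext (Category.assoc f.m g.m h.m)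

variable (A) in
/-- The functor `d^A` that forgets descent data. -/
def forget : LaxDesc A ⥤ A.obj ⟨one⟩ where
  obj x := x.w
  map f := f.m

end LaxDesc

open Limits

/-! If `G` is an equivalence followed by the forgetful functor, Beck's criterion applies. A descent
datum and its laws only involve images under functors out of `A(1)`, and functors preserve split
coequalizers. Hence a datum descends along a coequalizer `π` split in `A(1)`, and its laws can be
checked after cancelling images of `π`, which are split epimorphisms (`ofSplit`,
`isColimitOfSplit`). The forgetful functor also reflects isomorphisms.

Conversely, a monad `T` on `C` gives a strict functor on `Δ₃` with value `C` at `1` and the collage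
of `C(T -, -)` at `2`, so that a datum on `X` is a map `T X ⟶ X`. At `3` the profunctor `C(T (T -),
-)` is added; `D¹` inserts `μ` and `s⁰` inserts `η`, so the descent laws are the algebra laws
(`associativity_collagePseudofunctor_iff`, `identity_collagePseudofunctor_iff`). The comparison
functor then provides `K`. -/

theorem CategoryTheory.IsSplitCoequalizer.epi_map {C D : Type*} [Category* C] [Category* D]
    {X Y Z : C} {f g : X ⟶ Y} {π : Y ⟶ Z} (q : IsSplitCoequalizer f g π) (F : C ⥤ D) :
    Epi (F.map π) :=
  have : IsSplitEpi (F.map π) :=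
    IsSplitEpi.mk' ((SplitEpi.mk q.rightSection q.rightSection_π).map F)
  inferInstance

/-! ### Split coequalizers of descent data and Beck's criterion. -/

namespace LaxDesc

open Delta3 LaxDescent

variable {A : Pseudofunctor (LocallyDiscrete Delta3) Cat.{v, u}}

theorem hom_ext {x y : LaxDesc A} {f g : x ⟶ y} (h : f.m = g.m) : f = g := Hom.ext h

instance : (forget A).ReflectsIsomorphisms where
  reflects {x y} f hf := by
    change IsIso f.m at hf
    refine ⟨⟨{ m := inv f.m, comm := ?_ }, ?_, ?_⟩⟩
    · rw [Functor.map_inv, Functor.map_inv, IsIso.eq_inv_comp, ← Category.assoc, ← f.comm,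
        Category.assoc, IsIso.hom_inv_id, Category.comp_id]
    · exact hom_ext (IsIso.hom_inv_id f.m)
    · exact hom_ext (IsIso.inv_hom_id f.m)

section SplitCoequalizer

variable {x y : LaxDesc A} {f g : x ⟶ y} {z : A.obj ⟨one⟩} {π : y.w ⟶ z}
  (q : IsSplitCoequalizer f.m g.m π)

/-- The descent datum induced on a split coequalizer. -/
def descentDatum : (A.map d1.toLoc).toFunctor.obj z ⟶ (A.map d0.toLoc).toFunctor.obj z :=
  (A.map d1.toLoc).toFunctor.map q.rightSection ≫ y.φ ≫ (A.map d0.toLoc).toFunctor.map π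

/-- With `t` the left section, `π` followed by its section is `t ≫ f.m`. Compatibility of `f` moves
`f.m` across the datum, where `π` turns it into `g.m`; compatibility of `g` moves it back, and `t ≫
g.m` is the identity. -/
theorem map_comp_descentDatum :
    (A.map d1.toLoc).toFunctor.map π ≫ descentDatum q =
      y.φ ≫ (A.map d0.toLoc).toFunctor.map π := by
  rw [descentDatum, ← Functor.map_comp_assoc, ← q.leftSection_top, Functor.map_comp_assoc,
    ← reassoc_of% f.comm, ← Functor.map_comp, q.condition, Functor.map_comp,
    reassoc_of% g.comm, ← Functor.map_comp_assoc, q.leftSection_bottom, CategoryTheory.Functor.map_id,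
    Category.id_comp]

/-- The object of the lax descent category carried by a split coequalizer. -/
def ofSplit : LaxDesc A where
  w := z
  φ := descentDatum q
  associativity := by
    have h := map_comp_descentDatum q
    -- Both sides start at `A(D²)A(d¹)(z)`. Precomposed with the image of `π`, they reduce by `h`
    -- and naturality to the associativity law of `y`.
    have := q.epi_map (A.map d1.toLoc ≫ A.map D2.toLoc).toFunctor
    rw [← cancel_epi ((A.map d1.toLoc ≫ A.map D2.toLoc).toFunctor.map π)]
    have h0 := (sigma01 A).toNatTrans.naturality π
    have h1 := (sigma02 A).toNatTrans.naturality π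
    have h2 := (sigma12 A).toNatTrans.naturality π
    simp only [Cat.Hom.comp_map] at h0 h1 h2 ⊢
    rw [← Functor.map_comp_assoc, h, Functor.map_comp_assoc, reassoc_of% h1,
      ← Functor.map_comp, h, reassoc_of% h2, ← Functor.map_comp_assoc, h,
      Functor.map_comp, Functor.map_comp_assoc, h0, ← reassoc_of% y.associativity]
  identity := by
    have h := map_comp_descentDatum q
    have := q.epi_map (A.map d1.toLoc ≫ A.map s0.toLoc).toFunctor
    rw [← cancel_epi ((A.map d1.toLoc ≫ A.map s0.toLoc).toFunctor.map π)]
    have h0 := (nu0 A).toNatTrans.naturality π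
    have h1 := (nu1 A).toNatTrans.naturality π
    rw [h1, ← y.identity]
    simp only [Cat.Hom.comp_map] at h0 h1 ⊢
    rw [← Functor.map_comp_assoc, h, Functor.map_comp_assoc, h0, Category.assoc]

/-- The projection onto the split coequalizer. -/
def ofSplitπ : y ⟶ ofSplit q where
  m := π
  comm := (map_comp_descentDatum q).symm

theorem ofSplit_condition : f ≫ ofSplitπ q = g ≫ ofSplitπ q := hom_ext q.condition

/-- Precomposing with the epimorphism `A(d¹)(π)` turns this into the compatibility of `k`. -/
theorem comm_of_comp_eq {t : LaxDesc A} (k : y ⟶ t) (m : z ⟶ t.w) (hm : π ≫ m = k.m) :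
    descentDatum q ≫ (A.map d0.toLoc).toFunctor.map m =
      (A.map d1.toLoc).toFunctor.map m ≫ t.φ := by
  have := q.epi_map (A.map d1.toLoc).toFunctor
  rw [← cancel_epi ((A.map d1.toLoc).toFunctor.map π), reassoc_of% map_comp_descentDatum q,
    ← Functor.map_comp, ← Functor.map_comp_assoc, hm]
  exact k.comm

/-- The forgetful functor lifts split coequalizers. -/
def isColimitOfSplit : IsColimit (Cofork.ofπ (ofSplitπ q) (ofSplit_condition q)) :=
  Cofork.IsColimit.mk' _ fun s ↦ by
    have hs : f.m ≫ s.π.m = g.m ≫ s.π.m := congrArg Hom.m s.condition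
    have hπ : π ≫ q.rightSection ≫ s.π.m = s.π.m := by
      rw [← q.leftSection_top_assoc, hs, q.leftSection_bottom_assoc]
    refine ⟨{ m := q.rightSection ≫ s.π.m, comm := ?_ }, hom_ext hπ, fun {m} hm ↦ hom_ext ?_⟩
    · exact comm_of_comp_eq q s.π _ hπ
    · have hm' : π ≫ m.m = s.π.m := congrArg Hom.m hm
      change _ = q.rightSection ≫ s.π.m
      rw [← hm']
      exact (q.rightSection_π_assoc m.m).symm

end SplitCoequalizer

theorem hasCoequalizer_of_isSplitPair {x y : LaxDesc A} (f g : x ⟶ y)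
    [(forget A).IsSplitPair f g] : HasCoequalizer f g :=
  have ⟨_, _, ⟨q⟩⟩ := ‹(forget A).IsSplitPair f g›
  ⟨⟨_, isColimitOfSplit (f := f) (g := g) q⟩⟩

theorem preservesColimit_of_isSplitPair {x y : LaxDesc A} (f g : x ⟶ y)
    [(forget A).IsSplitPair f g] : PreservesColimit (parallelPair f g) (forget A) :=
  have ⟨_, _, ⟨q⟩⟩ := ‹(forget A).IsSplitPair f g›
  preservesColimit_of_preserves_colimit_cocone (isColimitOfSplit (f := f) (g := g) q)
    ((isColimitMapCoconeCoforkEquiv _ _).symm q.isCoequalizer)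

variable {B : Type u₁} [Category.{v} B]

/-- The composite of an equivalence with the functor that forgets descent data is monadic if it has
a left adjoint. -/
theorem nonempty_monadicRightAdjoint_comp_forget (K : B ⥤ LaxDesc A) [K.IsEquivalence]
    [(K ⋙ forget A).IsRightAdjoint] : Nonempty (MonadicRightAdjoint (K ⋙ forget A)) := by
  have split {X Y : B} (f g : X ⟶ Y) [h : (K ⋙ forget A).IsSplitPair f g] :
      (forget A).IsSplitPair (K.map f) (K.map g) := h
  -- The coequalizer exists for the image pair in the lax descent category and is carried back along
  -- the equivalence `K`.
  have : Monad.HasCoequalizerOfIsSplitPair (K ⋙ forget A) := ⟨fun f g _ ↦ by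
    have := split f g
    have : HasColimit (parallelPair ((parallelPair f g ⋙ K).map .left)
        ((parallelPair f g ⋙ K).map .right)) := hasCoequalizer_of_isSplitPair (K.map f) (K.map g)
    have := hasColimit_of_iso (diagramIsoParallelPair (parallelPair f g ⋙ K))
    exact Adjunction.hasColimit_of_comp_equivalence _ K⟩
  have : Monad.PreservesColimitOfIsSplitPair (K ⋙ forget A) := ⟨fun f g _ ↦ by
    have := split f g
    have : PreservesColimit (parallelPair ((parallelPair f g ⋙ K).map .left)
        ((parallelPair f g ⋙ K).map .right)) (forget A) :=
      preservesColimit_of_isSplitPair (K.map f) (K.map g)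
    have : PreservesColimit (parallelPair f g ⋙ K) (forget A) :=
      preservesColimit_of_iso_diagram _ (diagramIsoParallelPair (parallelPair f g ⋙ K)).symm
    infer_instance⟩
  exact ⟨Monad.monadicOfHasPreservesGSplitCoequalizersOfReflectsIsomorphisms
    (Adjunction.ofIsRightAdjoint (K ⋙ forget A))⟩

theorem nonempty_monadicRightAdjoint_of_eq {C : Cat.{v, u}} (G : B ⥤ C) (hG : G.IsRightAdjoint)
    (h : A.obj ⟨one⟩ = C) (K : B ⥤ LaxDesc A) [K.IsEquivalence]
    (e : G = K ⋙ forget A ⋙ (eqToHom h).toFunctor) : Nonempty (MonadicRightAdjoint G) := by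
  subst h
  -- Once `h` is `rfl`, the transport is an identity functor and drops out definitionally.
  obtain rfl : G = K ⋙ forget A := e
  exact nonempty_monadicRightAdjoint_comp_forget K

end LaxDesc

/-! ### The cosimplicial category of a monad. -/

namespace CategoryTheory.Monad

variable {C : Type u} [Category.{v} C] (T : Monad C)

/-- The objects of the collage of `T`: two copies of the objects of `C`. -/
inductive Collage (_T : Monad C) : Type u
  | src (X : C)
  | tgt (X : C)

/-- The objects of the double collage of `T`: three copies of the objects of `C`. -/
inductive DoubleCollage (_T : Monad C) : Type u
  | src (X : C)
  | mid (X : C)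
  | tgt (X : C)

namespace Collage

variable {T}

/-- Morphisms of the collage: those of `C` within the copies, and `T X ⟶ Y` from the first copy to
the second one. -/
def Hom : Collage T → Collage T → Type v
  | src X, src Y => X ⟶ Y
  | src X, tgt Y => (T : C ⥤ C).obj X ⟶ Y
  | tgt X, tgt Y => X ⟶ Y
  | tgt _, src _ => PEmpty

/-- The collage of the profunctor `C(T -, -)`. -/
instance : Category.{v} (Collage T) where
  Hom := Hom
  id
    | src X => 𝟙 X
    | tgt X => 𝟙 X
  comp {X Y Z} f g := match X, Y, Z, f, g with
    | src _, src _, src _, f, g => (f ≫ g :)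
    | src _, src _, tgt _, f, g => ((T : C ⥤ C).map f ≫ g :)
    | src _, tgt _, tgt _, f, g => (f ≫ g :)
    | tgt _, tgt _, tgt _, f, g => (f ≫ g :)
  id_comp {X Y} f := match X, Y, f with
    | src _, src _, f => Category.id_comp (obj := C) f
    | src _, tgt _, f => (congrArg (· ≫ f) ((T : C ⥤ C).map_id _)).trans (Category.id_comp (obj := C) f)
    | tgt _, tgt _, f => Category.id_comp (obj := C) f
  comp_id {X Y} f := match X, Y, f with
    | src _, src _, f => Category.comp_id (obj := C) f
    | src _, tgt _, f => Category.comp_id (obj := C) f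
    | tgt _, tgt _, f => Category.comp_id (obj := C) f
  assoc {X Y Z W} f g h := match X, Y, Z, W, f, g, h with
    | src _, src _, src _, src _, f, g, h => Category.assoc (obj := C) f g h
    | src _, src _, src _, tgt _, f, g, h => (T : C ⥤ C).map_comp_assoc f g h
    | src _, src _, tgt _, tgt _, _, g, h => Category.assoc (obj := C) _ g h
    | src _, tgt _, tgt _, tgt _, f, g, h => Category.assoc (obj := C) f g h
    | tgt _, tgt _, tgt _, tgt _, f, g, h => Category.assoc (obj := C) f g h

variable (T)

/-- The first copy of `C`. -/
def srcFunctor : C ⥤ Collage T where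
  obj := src
  map f := f

/-- The second copy of `C`. -/
def tgtFunctor : C ⥤ Collage T where
  obj := tgt
  map f := f

/-- The functor that collapses the collage by means of the unit of `T`. -/
def collapse : Collage T ⥤ C where
  obj
    | src X => X
    | tgt X => X
  map {X Y} f := match X, Y, f with
    | src _, src _, f => f
    | src X, tgt _, f => (T.η.app X ≫ f :)
    | tgt _, tgt _, f => f
  map_id X := match X with
    | src _ => rfl
    | tgt _ => rfl
  map_comp {X Y Z} f g := match X, Y, Z, f, g with
    | src _, src _, src _, _, _ => rfl
    | src _, src _, tgt _, f, g => (T.η.naturality_assoc f g).symm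
    | src _, tgt _, tgt _, f, g => (Category.assoc (obj := C) _ f g).symm
    | tgt _, tgt _, tgt _, _, _ => rfl

end Collage

namespace DoubleCollage

variable {T}

/-- Morphisms of the double collage. -/
def Hom : DoubleCollage T → DoubleCollage T → Type v
  | src X, src Y => X ⟶ Y
  | src X, mid Y => (T : C ⥤ C).obj X ⟶ Y
  | src X, tgt Y => (T : C ⥤ C).obj ((T : C ⥤ C).obj X) ⟶ Y
  | mid X, mid Y => X ⟶ Y
  | mid X, tgt Y => (T : C ⥤ C).obj X ⟶ Y
  | tgt X, tgt Y => X ⟶ Y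
  | mid _, src _ => PEmpty
  | tgt _, src _ => PEmpty
  | tgt _, mid _ => PEmpty

/-- Three copies of `C`, related by the profunctors `C(T -, -)` and `C(T (T -), -)`. -/
instance : Category.{v} (DoubleCollage T) where
  Hom := Hom
  id
    | src X => 𝟙 X
    | mid X => 𝟙 X
    | tgt X => 𝟙 X
  comp {X Y Z} f g := match X, Y, Z, f, g with
    | src _, src _, src _, f, g => (f ≫ g :)
    | src _, src _, mid _, f, g => ((T : C ⥤ C).map f ≫ g :)
    | src _, src _, tgt _, f, g => ((T : C ⥤ C).map ((T : C ⥤ C).map f) ≫ g :)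
    | src _, mid _, mid _, f, g => (f ≫ g :)
    -- The composite keeps the domain `T (T X)`: the multiplication is not used here, only in
    -- `srcTgt`.
    | src _, mid _, tgt _, f, g => ((T : C ⥤ C).map f ≫ g :)
    | src _, tgt _, tgt _, f, g => (f ≫ g :)
    | mid _, mid _, mid _, f, g => (f ≫ g :)
    | mid _, mid _, tgt _, f, g => ((T : C ⥤ C).map f ≫ g :)
    | mid _, tgt _, tgt _, f, g => (f ≫ g :)
    | tgt _, tgt _, tgt _, f, g => (f ≫ g :)
  id_comp {X Y} f := match X, Y, f with
    | src _, src _, f => Category.id_comp (obj := C) f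
    | src _, mid _, f => (congrArg (· ≫ f) ((T : C ⥤ C).map_id _)).trans (Category.id_comp (obj := C) f)
    | src _, tgt _, f => by
      exact (congrArg (· ≫ f) ((congrArg (T : C ⥤ C).map ((T : C ⥤ C).map_id _)).trans
        ((T : C ⥤ C).map_id _))).trans (Category.id_comp (obj := C) f)
    | mid _, mid _, f => Category.id_comp (obj := C) f
    | mid _, tgt _, f => (congrArg (· ≫ f) ((T : C ⥤ C).map_id _)).trans (Category.id_comp (obj := C) f)
    | tgt _, tgt _, f => Category.id_comp (obj := C) f
  comp_id {X Y} f := match X, Y, f with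
    | src _, src _, f => Category.comp_id (obj := C) f
    | src _, mid _, f => Category.comp_id (obj := C) f
    | src _, tgt _, f => Category.comp_id (obj := C) f
    | mid _, mid _, f => Category.comp_id (obj := C) f
    | mid _, tgt _, f => Category.comp_id (obj := C) f
    | tgt _, tgt _, f => Category.comp_id (obj := C) f
  assoc {X Y Z W} f g h := match X, Y, Z, W, f, g, h with
    | src _, src _, src _, src _, f, g, h => Category.assoc (obj := C) f g h
    | src _, src _, src _, mid _, f, g, h => (T : C ⥤ C).map_comp_assoc f g h
    | src _, src _, src _, tgt _, f, g, h => ((T : C ⥤ C) ⋙ (T : C ⥤ C)).map_comp_assoc f g h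
    | src _, src _, mid _, mid _, f, g, h => Category.assoc (obj := C) _ g h
    | src _, src _, mid _, tgt _, f, g, h => (T : C ⥤ C).map_comp_assoc ((T : C ⥤ C).map f) g h
    | src _, src _, tgt _, tgt _, f, g, h => Category.assoc (obj := C) _ g h
    | src _, mid _, mid _, mid _, f, g, h => Category.assoc (obj := C) f g h
    | src _, mid _, mid _, tgt _, f, g, h => (T : C ⥤ C).map_comp_assoc f g h
    | src _, mid _, tgt _, tgt _, f, g, h => Category.assoc (obj := C) _ g h
    | src _, tgt _, tgt _, tgt _, f, g, h => Category.assoc (obj := C) f g h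
    | mid _, mid _, mid _, mid _, f, g, h => Category.assoc (obj := C) f g h
    | mid _, mid _, mid _, tgt _, f, g, h => (T : C ⥤ C).map_comp_assoc f g h
    | mid _, mid _, tgt _, tgt _, f, g, h => Category.assoc (obj := C) _ g h
    | mid _, tgt _, tgt _, tgt _, f, g, h => Category.assoc (obj := C) f g h
    | tgt _, tgt _, tgt _, tgt _, f, g, h => Category.assoc (obj := C) f g h

variable (T)

/-- The inclusion of the collage on the first two copies of `C`. -/
def srcMid : Collage T ⥤ DoubleCollage T where
  obj
    | .src X => src X
    | .tgt X => mid X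
  map {X Y} f := match X, Y, f with
    | .src _, .src _, f => f
    | .src _, .tgt _, f => f
    | .tgt _, .tgt _, f => f
  map_id X := match X with
    | .src _ => rfl
    | .tgt _ => rfl
  map_comp {X Y Z} f g := match X, Y, Z, f, g with
    | .src _, .src _, .src _, _, _ => rfl
    | .src _, .src _, .tgt _, _, _ => rfl
    | .src _, .tgt _, .tgt _, _, _ => rfl
    | .tgt _, .tgt _, .tgt _, _, _ => rfl

/-- The inclusion of the collage on the last two copies of `C`. -/
def midTgt : Collage T ⥤ DoubleCollage T where
  obj
    | .src X => mid X
    | .tgt X => tgt X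
  map {X Y} f := match X, Y, f with
    | .src _, .src _, f => f
    | .src _, .tgt _, f => f
    | .tgt _, .tgt _, f => f
  map_id X := match X with
    | .src _ => rfl
    | .tgt _ => rfl
  map_comp {X Y Z} f g := match X, Y, Z, f, g with
    | .src _, .src _, .src _, _, _ => rfl
    | .src _, .src _, .tgt _, _, _ => rfl
    | .src _, .tgt _, .tgt _, _, _ => rfl
    | .tgt _, .tgt _, .tgt _, _, _ => rfl

/-- The functor from the collage to the outer copies of `C`, given by the multiplication of `T`. -/
def srcTgt : Collage T ⥤ DoubleCollage T where
  obj
    | .src X => src X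
    | .tgt X => tgt X
  map {X Y} f := match X, Y, f with
    | .src _, .src _, f => f
    | .src X, .tgt _, f => (T.μ.app X ≫ f :)
    | .tgt _, .tgt _, f => f
  map_id X := match X with
    | .src _ => rfl
    | .tgt _ => rfl
  map_comp {X Y Z} f g := match X, Y, Z, f, g with
    | .src _, .src _, .src _, _, _ => rfl
    | .src _, .src _, .tgt _, f, g => (T.μ.naturality_assoc f g).symm
    | .src _, .tgt _, .tgt _, f, g => (Category.assoc (obj := C) _ f g).symm
    | .tgt _, .tgt _, .tgt _, _, _ => rfl

end DoubleCollage

open Collage DoubleCollage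

/-- The vertices of the cosimplicial category of a monad. -/
def collageObj : Delta3Quiver → Cat.{v, u}
  | .one => Cat.of C
  | .two => Cat.of (Collage T)
  | .three => Cat.of (DoubleCollage T)

/-- The generators of the cosimplicial category of a monad. -/
def collageMap : ∀ {a b : Delta3Quiver}, Delta3Quiver.Hom a b → (T.collageObj a ⟶ T.collageObj b)
  | _, _, .d0 => (tgtFunctor T).toCatHom
  | _, _, .d1 => (srcFunctor T).toCatHom
  | _, _, .s0 => (collapse T).toCatHom
  | _, _, .D0 => (midTgt T).toCatHom
  | _, _, .D1 => (srcTgt T).toCatHom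
  | _, _, .D2 => (srcMid T).toCatHom

/-- The strict functor `Δ₃ ⥤ Cat` of a monad. -/
def collageFunctor : Delta3 ⥤ Cat.{v, u} :=
  CategoryTheory.Quotient.lift _
    (Paths.lift (V := Delta3Quiver) { obj := T.collageObj, map := T.collageMap }) <| by
      rintro _ _ _ _ (_ | _ | _ | _ | _) <;> rfl

/-- The pseudofunctor on `Δ₃` whose lax descent category is the category of algebras. -/
def collagePseudofunctor : Pseudofunctor (LocallyDiscrete Delta3) Cat.{v, u} :=
  T.collageFunctor.toPseudofunctor'

open LaxDescent Delta3



/-! ### Structure cells of a pseudofunctor that comes from a strict functor. -/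

section

variable {I B : Type*} [Category* I] [Bicategory B] [Bicategory.Strict B] (F : I ⥤ B)
  {i j j' k : LocallyDiscrete I}

theorem _root_.CategoryTheory.Functor.toPseudofunctor'_mapComp' (f : i ⟶ j)
    (g : j ⟶ k) (fg : i ⟶ k) (h : f ≫ g = fg) :
    F.toPseudofunctor'.mapComp' f g fg h =
      eqToIso (by subst h; exact F.map_comp f.as g.as) := by
  subst h
  rw [Pseudofunctor.mapComp'_eq_mapComp]
  rfl

/-- This is the shape of the cells `A(σᵢⱼ)`. -/
theorem _root_.CategoryTheory.Functor.toPseudofunctor'_mapComp'_inv_comp_hom (f : i ⟶ j)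
    (g : j ⟶ k) (f' : i ⟶ j') (g' : j' ⟶ k) (fg : i ⟶ k) (h : f ≫ g = fg) (h' : f' ≫ g' = fg) :
    (F.toPseudofunctor'.mapComp' f g fg h).inv ≫ (F.toPseudofunctor'.mapComp' f' g' fg h').hom =
      eqToHom ((F.map_comp f.as g.as).symm.trans
        ((congrArg (fun u : i ⟶ k ↦ F.map u.as) (h.trans h'.symm)).trans
          (F.map_comp f'.as g'.as))) := by
  rw [F.toPseudofunctor'_mapComp', F.toPseudofunctor'_mapComp']
  exact eqToHom_trans
    ((F.map_comp f.as g.as).symm.trans (congrArg (fun u : i ⟶ k ↦ F.map u.as) h))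
    ((congrArg (fun u : i ⟶ k ↦ F.map u.as) h'.symm).trans (F.map_comp f'.as g'.as))

theorem _root_.CategoryTheory.Functor.toPseudofunctor'_mapComp'_inv_comp_mapId (f : i ⟶ j)
    (g : j ⟶ i) (h : f ≫ g = 𝟙 i) :
    (F.toPseudofunctor'.mapComp' f g (𝟙 i) h).inv ≫ (F.toPseudofunctor'.mapId i).hom =
      eqToHom ((F.map_comp f.as g.as).symm.trans
        ((congrArg (fun u : i ⟶ i ↦ F.map u.as) h).trans (F.map_id i.as))) := by
  rw [F.toPseudofunctor'_mapComp']
  exact eqToHom_trans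
    ((F.map_comp f.as g.as).symm.trans (congrArg (fun u : i ⟶ i ↦ F.map u.as) h))
    (F.map_id i.as)

end

theorem sigma01_collagePseudofunctor_app (X : C) :
    (sigma01 T.collagePseudofunctor).toNatTrans.app X =
      𝟙 (DoubleCollage.tgt X : DoubleCollage T) := by
  -- The two composite functors agree definitionally, so the cell is an identity.
  have : sigma01 T.collagePseudofunctor = eqToHom rfl :=
    T.collageFunctor.toPseudofunctor'_mapComp'_inv_comp_hom _ _ _ _ _ _ _
  rw [this]
  rfl

theorem sigma02_collagePseudofunctor_app (X : C) :
    (sigma02 T.collagePseudofunctor).toNatTrans.app X =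
      𝟙 (DoubleCollage.mid X : DoubleCollage T) := by
  have : sigma02 T.collagePseudofunctor = eqToHom rfl :=
    T.collageFunctor.toPseudofunctor'_mapComp'_inv_comp_hom _ _ _ _ _ _ _
  rw [this]
  rfl

theorem sigma12_collagePseudofunctor_app (X : C) :
    (sigma12 T.collagePseudofunctor).toNatTrans.app X =
      𝟙 (DoubleCollage.src X : DoubleCollage T) := by
  have : sigma12 T.collagePseudofunctor = eqToHom rfl :=
    T.collageFunctor.toPseudofunctor'_mapComp'_inv_comp_hom _ _ _ _ _ _ _
  rw [this]
  rfl

theorem nu0_collagePseudofunctor_app (X : C) :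
    (nu0 T.collagePseudofunctor).toNatTrans.app X = 𝟙 X := by
  have : nu0 T.collagePseudofunctor = eqToHom _ :=
    T.collageFunctor.toPseudofunctor'_mapComp'_inv_comp_mapId _ _ _
  rw [this]
  exact Cat.eqToHom_app (C := Cat.of C) (D := Cat.of C)
    (T.collageFunctor.map d0 ≫ T.collageFunctor.map s0) (𝟙 _) _ X

theorem nu1_collagePseudofunctor_app (X : C) :
    (nu1 T.collagePseudofunctor).toNatTrans.app X = 𝟙 X := by
  have : nu1 T.collagePseudofunctor = eqToHom _ :=
    T.collageFunctor.toPseudofunctor'_mapComp'_inv_comp_mapId _ _ _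
  rw [this]
  exact Cat.eqToHom_app (C := Cat.of C) (D := Cat.of C)
    (T.collageFunctor.map d1 ≫ T.collageFunctor.map s0) (𝟙 _) _ X

end CategoryTheory.Monad

/-! ### Descent data on the collage are algebras. -/

namespace CategoryTheory.Monad

variable {C : Type u} [Category.{v} C] (T : Monad C)

open LaxDescent Delta3

/-- The `σ` cells are identities. One side is the composite of `a` with itself through the middle
copy, where `T` is applied to the first factor; the other is the image of `a` under `D¹`, which
precomposes with `μ`. -/
theorem associativity_collagePseudofunctor_iff {X : C} (a : (T : C ⥤ C).obj X ⟶ X) :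
    ((T.collagePseudofunctor.map D2.toLoc).toFunctor.map (X := Collage.src X) (Y := Collage.tgt X) a ≫
        (sigma02 T.collagePseudofunctor).toNatTrans.app X ≫
          (T.collagePseudofunctor.map D0.toLoc).toFunctor.map
            (X := Collage.src X) (Y := Collage.tgt X) a =
      (sigma12 T.collagePseudofunctor).toNatTrans.app X ≫
        (T.collagePseudofunctor.map D1.toLoc).toFunctor.map
          (X := Collage.src X) (Y := Collage.tgt X) a ≫
          (sigma01 T.collagePseudofunctor).toNatTrans.app X) ↔
      T.μ.app X ≫ a = (T : C ⥤ C).map a ≫ a := by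
  have h2 : (T.collagePseudofunctor.map D2.toLoc).toFunctor.map
      (X := Collage.src X) (Y := Collage.tgt X) a ≫
        (sigma02 T.collagePseudofunctor).toNatTrans.app X ≫
          (T.collagePseudofunctor.map D0.toLoc).toFunctor.map
            (X := Collage.src X) (Y := Collage.tgt X) a = ((T : C ⥤ C).map a ≫ a :) := by
    rw [sigma02_collagePseudofunctor_app]
    -- The identity of the middle object acts on a morphism to the last copy as `T` of an identity.
    exact congrArg ((T : C ⥤ C).map a ≫ ·)
      ((congrArg (· ≫ a) ((T : C ⥤ C).map_id _)).trans (Category.id_comp (obj := C) a))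
  have h1 : (sigma12 T.collagePseudofunctor).toNatTrans.app X ≫
        (T.collagePseudofunctor.map D1.toLoc).toFunctor.map
          (X := Collage.src X) (Y := Collage.tgt X) a ≫
          (sigma01 T.collagePseudofunctor).toNatTrans.app X = (T.μ.app X ≫ a :) := by
    rw [sigma01_collagePseudofunctor_app, sigma12_collagePseudofunctor_app]
    exact (Category.id_comp (obj := DoubleCollage T) _).trans
      (Category.comp_id (obj := DoubleCollage T) _)
  rw [h1, h2]
  exact eq_comm

theorem identity_collagePseudofunctor_iff {X : C} (a : (T : C ⥤ C).obj X ⟶ X) :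
    ((T.collagePseudofunctor.map s0.toLoc).toFunctor.map (X := Collage.src X) (Y := Collage.tgt X) a ≫
        (nu0 T.collagePseudofunctor).toNatTrans.app X =
      (nu1 T.collagePseudofunctor).toNatTrans.app X) ↔ T.η.app X ≫ a = 𝟙 X := by
  rw [nu0_collagePseudofunctor_app, nu1_collagePseudofunctor_app]
  exact Eq.congr_left (Category.comp_id (obj := C) (T.η.app X ≫ a))

/-- Algebras as descent data. -/
def algebraToLaxDesc : T.Algebra ⥤ LaxDesc T.collagePseudofunctor where
  obj X :=
    { w := X.A
      φ := X.a
      associativity := (T.associativity_collagePseudofunctor_iff X.a).2 X.assoc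
      identity := (T.identity_collagePseudofunctor_iff X.a).2 X.unit }
  map f := { m := f.f, comm := f.h.symm }

/-- Descent data as algebras. -/
def laxDescToAlgebra : LaxDesc T.collagePseudofunctor ⥤ T.Algebra where
  obj x :=
    { A := x.w
      a := x.φ
      assoc := (T.associativity_collagePseudofunctor_iff x.φ).1 x.associativity
      unit := (T.identity_collagePseudofunctor_iff x.φ).1 x.identity }
  map f := { f := f.m, h := f.comm.symm }

/-- The algebras of a monad are the lax descent data of its collage pseudofunctor. -/
def algebraEquivLaxDesc : T.Algebra ≌ LaxDesc T.collagePseudofunctor where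
  functor := T.algebraToLaxDesc
  inverse := T.laxDescToAlgebra
  unitIso := Iso.refl _
  counitIso := Iso.refl _
  functor_unitIso_comp _ := Category.comp_id (𝟙 _)

instance : T.algebraToLaxDesc.IsEquivalence := T.algebraEquivLaxDesc.isEquivalence_functor

end CategoryTheory.Monad

/-- A functor with a left adjoint is monadic if and only if it is, up to an equivalence, the functor
forgetting the descent data of some pseudofunctor `Δ₃ → Cat`. -/
theorem theorem2p7 {B : Type u₁} [Category.{v} B] {C : Type u₂} [Category.{v} C] (G : B ⥤ C)
    (hG : G.IsRightAdjoint) :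
    Nonempty (MonadicRightAdjoint G) ↔
      ∃ (A : Pseudofunctor (LocallyDiscrete Delta3) Cat.{v, u₂})
        (h : A.obj ⟨Delta3.one⟩ = Cat.of C) (K : B ⥤ LaxDesc A),
        K.IsEquivalence ∧ G = K ⋙ LaxDesc.forget A ⋙ (eqToHom h).toFunctor := by
  refine ⟨fun ⟨_⟩ ↦ ?_, fun ⟨A, h, K, _, e⟩ ↦
    LaxDesc.nonempty_monadicRightAdjoint_of_eq (C := Cat.of C) G hG h K e⟩
  -- The factorization is strict because both functors composed here keep underlying objects and
  -- morphisms.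
  exact ⟨(monadicAdjunction G).toMonad.collagePseudofunctor, rfl,
    Monad.comparison (monadicAdjunction G) ⋙ (monadicAdjunction G).toMonad.algebraToLaxDesc,
    inferInstance, rfl⟩
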